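/- Let $n\in\mathbb N$ and let $L:\mathbb R^n\times\mathbb R^n\to[0,\infty)$ be a continuous function such that $L(x,\cdot)$ is convex for every $x$ and such that, for some $\Theta:\mathbb R^n\to[0,\infty)$ with $\lim_{|u|\to\infty}\Theta(u)/|u|=+\infty$, one has $L(x,u)\ge\Theta(u)$ for all $(x,u)$. Put $H(x,p)=\sup_{u\in\mathbb R^n}\big(\langle p,u\rangle-L(x,u)\big)$. Let $W:[0,\infty)\times\mathbb R^n\to\mathbb R\cup\{+\infty\}$ be lower semicontinuous, extended by $+\infty$ to $\mathbb R\times\mathbb R^n$, and let $\mathrm{dom}(W)=\{W<+\infty\}$. For $z\in\mathrm{dom}(W)$ and $w\in\mathbb R\times\mathbb R^n$ let $$D_\uparrow W(z)(w)=\liminf_{h\to0+,\,v\to w}\frac{W(z+hv)-W(z)}{h},\qquad D_\downarrow W(z)(w)=\limsup_{h\to0+,\,v\to w}\frac{W(z+hv)-W(z)}{h},$$ $$\partial_-W(z)=\Big\{p\in\mathbb R\times\mathbb R^n:\ \liminf_{y\to z}\frac{W(y)-W(z)-\langle p,y-z\rangle}{|y-z|}\ge0\Big\},$$ and let $\partial_-W(z)=\emptyset$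 if $z\notin\mathrm{dom}(W)$. Then the following three conditions are equivalent: 1. $D_\downarrow W(t,x)(1,-u)\le L(x,u)$ for all $(t,x)\in\mathrm{dom}(W)$ and all $u\in\mathbb R^n$; 2. $D_\uparrow W(t,x)(1,-u)\le L(x,u)$ for all $(t,x)\in\mathrm{dom}(W)$ and all $u\in\mathbb R^n$; 3. $p_t+H(x,-p_x)\le0$ for all $(t,x)\in[0,\infty)\times\mathbb R^n$ and all $(p_t,p_x)\in\partial_-W(t,x)$. The three conditions obtained from 1, 2, 3 by restricting to points $(t,x)$ with $t>0$ are likewise equivalent to one another. -/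

import Mathlib

open Set Filter Topology
open scoped NNReal

noncomputable section

section GeneralFunctions

variable {X : Type*} [NormedAddCommGroup X] [InnerProductSpace ℝ X]

/-- The effective domain of an extended-valued function. -/
def effDom {Y : Type*} (W : Y → EReal) : Set Y := {z | W z ≠ ⊤}

/-- The lower contingent derivative
`D↑W(x)(u) = liminf_{h → 0+, v → u} (W(x + h v) - W(x)) / h`, as an extended real number. -/
def lowerContingentDeriv (W : X → EReal) (x u : X) : EReal :=
  liminf (fun q : ℝ × X => (W (x + q.1 • q.2) - W x) / ((q.1 : ℝ) : EReal))
    (𝓝[>] (0 : ℝ) ×ˢ 𝓝 u)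

/-- The upper contingent derivative
`D↓W(x)(u) = limsup_{h → 0+, v → u} (W(x + h v) - W(x)) / h`, as an extended real number. -/
def upperContingentDeriv (W : X → EReal) (x u : X) : EReal :=
  limsup (fun q : ℝ × X => (W (x + q.1 • q.2) - W x) / ((q.1 : ℝ) : EReal))
    (𝓝[>] (0 : ℝ) ×ˢ 𝓝 u)

/-- The subdifferential `∂₋W(x)`: it consists of all `p` such that
`liminf_{y → x} (W(y) - W(x) - ⟨p, y - x⟩) / |y - x| ≥ 0` if `x` is in the domain of `W`,
and is empty otherwise. -/
def subdiff (W : X → EReal) (x : X) : Set X :=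
  {p | x ∈ effDom W ∧
    0 ≤ liminf (fun y : X =>
      (W y - W x - ((inner ℝ p (y - x) : ℝ) : EReal)) / ((‖y - x‖ : ℝ) : EReal)) (𝓝[≠] x)}

end GeneralFunctions

/-- `ℝⁿ` with its Euclidean structure. -/
abbrev Space (n : ℕ) : Type := EuclideanSpace ℝ (Fin n)

/-- `ℝ × ℝⁿ` with its Euclidean structure (the `ℓ²` product norm and inner product). -/
abbrev SpaceTime (n : ℕ) : Type := WithLp 2 (ℝ × Space n)

/-- The point `(t, x)` of `ℝ × ℝⁿ`. -/
def stPoint {n : ℕ} (t : ℝ) (x : Space n) : SpaceTime n := WithLp.toLp 2 (t, x)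

/-- The extension by `+∞` to `ℝ × ℝⁿ` of a function defined on `ℝ₊ × ℝⁿ`. -/
def extendTop {n : ℕ} (W : ℝ≥0 × Space n → EReal) : SpaceTime n → EReal :=
  fun z => if h : 0 ≤ z.fst then W (⟨z.fst, h⟩, z.snd) else ⊤

/-- The Hamiltonian `H(x,p) = sup_u (⟨p,u⟩ - L(x,u))`, as an extended real number. -/
def hamiltonian {n : ℕ} (L : Space n → Space n → ℝ) (x p : Space n) : EReal :=
  ⨆ u : Space n, ((inner ℝ p u - L x u : ℝ) : EReal)

/-- Tonelli's coercivity: `L(x,u) ≥ Θ(u)` for some `Θ ≥ 0` with `Θ(u)/|u| → +∞`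
as `|u| → ∞`. -/
def TonelliCoercive {n : ℕ} (L : Space n → Space n → ℝ) : Prop :=
  ∃ Θ : Space n → ℝ, (∀ u, 0 ≤ Θ u) ∧
    Tendsto (fun u => Θ u / ‖u‖) (Bornology.cobounded (Space n)) atTop ∧
    ∀ x u, Θ u ≤ L x u

end

/-!
The three conditions are linked by the subgradient inequality in one direction and by a nonsmooth
mean value inequality in the other.

The lower derivative never exceeds the upper one. If `p` is a subgradient of `W` at `z`, then
`⟨p, v⟩ ≤ D↑W(z)(v)` for every direction `v` (`inner_le_lowerContingentDeriv`). For
`v = (1, -u)` this turns the bound on `D↑W` into `p_t + ⟨-p_x, u⟩ - L(x, u) ≤ 0`, and the supremum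
over `u` is the Hamilton-Jacobi inequality.

For the converse, the Hamilton-Jacobi inequality at a point `(s, y)`, scaled by `v_t > 0`, says
`⟨p, v⟩ ≤ v_t L(y, -v_x / v_t)` for every subgradient `p`. The right-hand side is continuous in
`(y, v)` and equals `L(x, u)` at `(x, (1, -u))`, so `⟨p, v⟩ ≤ M` for any `M > L(x, u)` as soon as
the base point is close to `(t, x)` and `v` is close to `(1, -u)`. The mean value inequality
`le_add_mul_of_inner_subdiff_le` integrates this to `W(z + h v) ≤ W(z) + M h` for small `h`,
uniformly in `v`, which bounds the upper derivative by `M`. In particular it shows that `W` is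
finite at `z + h v`, although the subdifferential carries no information at points where
`W = +∞`.

The argument is local, so it also applies to the conditions restricted to `t > 0`. At `t = 0` the
extension by `+∞` causes no difficulty: it is lower semicontinuous on `ℝ × ℝⁿ` and has no
subgradients at negative times.
-/

/-! ### Subgradients and contingent derivatives -/

section Subgradients

variable {X : Type*} [NormedAddCommGroup X] [InnerProductSpace ℝ X]

theorem EReal.coe_le_sub_div_iff {e : EReal} {a c h : ℝ} (hh : 0 < h) :
    (c : EReal) ≤ (e - a) / (h : EReal) ↔ ((a + c * h : ℝ) : EReal) ≤ e := by
  rw [EReal.le_div_iff_mul_le (by exact_mod_cast hh) (EReal.coe_ne_top _),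
    EReal.le_sub_iff_add_le (by simp) (by simp), add_comm]
  norm_cast

theorem EReal.sub_div_le_coe_iff {e : EReal} {a c h : ℝ} (hh : 0 < h) :
    (e - a) / (h : EReal) ≤ c ↔ e ≤ ((a + c * h : ℝ) : EReal) := by
  rw [EReal.div_le_iff_le_mul (by exact_mod_cast hh) (EReal.coe_ne_top _),
    EReal.sub_le_iff_le_add (by simp) (by simp), add_comm]
  norm_cast
  rw [mul_comm h c]

/-- The `ε`-form of the subgradient condition at a point where `F` is finite. -/
theorem mem_subdiff_iff {F : X → EReal} {x p : X} {a : ℝ} (hx : F x = a) :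
    p ∈ subdiff F x ↔ ∀ ε > 0, ∀ᶠ y in 𝓝 x,
      ((a + inner ℝ p (y - x) - ε * ‖y - x‖ : ℝ) : EReal) ≤ F y := by
  have key : ∀ (ε : ℝ) (y : X), y ≠ x →
      (((-ε : ℝ) : EReal) ≤
        (F y - F x - ((inner ℝ p (y - x) : ℝ) : EReal)) / ((‖y - x‖ : ℝ) : EReal) ↔
      ((a + inner ℝ p (y - x) - ε * ‖y - x‖ : ℝ) : EReal) ≤ F y) := by
    intro ε y hy
    have hsub : F y - F x - ((inner ℝ p (y - x) : ℝ) : EReal) =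
        F y - ((a + inner ℝ p (y - x) : ℝ) : EReal) := by
      rw [hx]
      induction F y with
      | bot => simp
      | top => norm_cast
      | coe b => norm_cast; ring
    rw [hsub, EReal.coe_le_sub_div_iff (norm_pos_iff.2 (sub_ne_zero.2 hy)), neg_mul,
      ← sub_eq_add_neg]
  constructor
  · rintro ⟨-, hp⟩ ε hε
    have hlt : ((-ε : ℝ) : EReal) < 0 := by exact_mod_cast neg_lt_zero.2 hε
    have h := eventually_nhdsWithin_iff.1 (eventually_lt_of_lt_liminf (hlt.trans_le hp))
    filter_upwards [h] with y hy
    rcases eq_or_ne y x with rfl | hne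
    · simp [hx]
    · exact (key ε y hne).1 (hy hne).le
  · refine fun h => ⟨by simp [effDom, hx], le_of_forall_lt fun c hc => ?_⟩
    obtain ⟨d, hcd, hd⟩ := EReal.lt_iff_exists_real_btwn.1 hc
    refine hcd.trans_le (le_liminf_of_le (by isBoundedDefault) ?_)
    have hd0 : 0 < -d := neg_pos.2 (by exact_mod_cast hd)
    filter_upwards [nhdsWithin_le_nhds (h _ hd0), self_mem_nhdsWithin] with y hy hne
    simpa using (key (-d) y hne).2 hy

theorem mem_subdiff_of_quadratic_minorant {F : X → EReal} {x p : X} {a k : ℝ} (hx : F x = a)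
    (h : ∀ᶠ y in 𝓝 x, ((a + inner ℝ p (y - x) - k * ‖y - x‖ ^ 2 : ℝ) : EReal) ≤ F y) :
    p ∈ subdiff F x := by
  refine (mem_subdiff_iff hx).2 fun ε hε => ?_
  have hcont : Continuous fun y : X => k * ‖y - x‖ := by fun_prop
  filter_upwards [h, hcont.continuousAt.eventually_lt continuousAt_const
    (by simpa using hε : k * ‖x - x‖ < ε)] with y h1 h2
  refine le_trans (EReal.coe_le_coe_iff.2 ?_) h1
  nlinarith [norm_nonneg (y - x)]

/-- Subgradient inequality: a subgradient minorises the lower contingent derivative. -/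
theorem inner_le_lowerContingentDeriv {F : X → EReal} {x p : X} (hbot : F x ≠ ⊥)
    (hp : p ∈ subdiff F x) (v : X) :
    ((inner ℝ p v : ℝ) : EReal) ≤ lowerContingentDeriv F x v := by
  obtain ⟨a, ha⟩ : ∃ a : ℝ, F x = a := ⟨(F x).toReal, (EReal.coe_toReal hp.1 hbot).symm⟩
  refine le_of_forall_lt fun c' hc' => ?_
  obtain ⟨c, hcc, hc⟩ := EReal.lt_iff_exists_real_btwn.1 hc'
  have hc : c < inner ℝ p v := by exact_mod_cast hc
  refine hcc.trans_le (le_liminf_of_le (by isBoundedDefault) ?_)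
  obtain ⟨ε, hε, hεc⟩ : ∃ ε > 0, c < inner ℝ p v - ε * ‖v‖ := by
    refine ⟨(inner ℝ p v - c) / (‖v‖ + 1), div_pos (by linarith) (by positivity), ?_⟩
    have h1 : (inner ℝ p v - c) / (‖v‖ + 1) * (‖v‖ + 1) = inner ℝ p v - c :=
      div_mul_cancel₀ _ (by positivity)
    have h2 : 0 < (inner ℝ p v - c) / (‖v‖ + 1) := div_pos (by linarith) (by positivity)
    linarith
  have hle : 𝓝[>] (0 : ℝ) ×ˢ 𝓝 v ≤ 𝓝 (0, v) := by
    rw [nhds_prod_eq]; exact Filter.prod_mono_left _ nhdsWithin_le_nhds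
  have hcont : Continuous fun q : ℝ × X => x + q.1 • q.2 := by fun_prop
  have hlim : Tendsto (fun q : ℝ × X => x + q.1 • q.2) (𝓝[>] (0 : ℝ) ×ˢ 𝓝 v) (𝓝 x) := by
    simpa using (hcont.tendsto (0, v)).mono_left hle
  have hcont' : Continuous fun q : ℝ × X => inner ℝ p q.2 - ε * ‖q.2‖ := by fun_prop
  filter_upwards [hlim.eventually ((mem_subdiff_iff ha).1 hp ε hε),
    hle (hcont'.continuousAt.eventually (lt_mem_nhds hεc)),
    tendsto_fst.eventually self_mem_nhdsWithin] with q h1 h2 h3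
  have h3 : 0 < q.1 := h3
  rw [ha, EReal.coe_le_sub_div_iff h3]
  refine le_trans (EReal.coe_le_coe_iff.2 ?_) h1
  rw [add_sub_cancel_left, real_inner_smul_right, norm_smul, Real.norm_of_nonneg h3.le]
  have h2 : c < inner ℝ p q.2 - ε * ‖q.2‖ := h2
  nlinarith

/-! ### The mean value inequality -/

variable [ProperSpace X]

/-- Mean value inequality for extended-valued lower semicontinuous functions: an upper bound `M` for
all subgradients in direction `v` near `z` bounds the increment of `F` along `v`.

If `F (z + h v) > F z + M h`, pick a slope `σ > M` with `F (z + h v) > F z + σ h` and minimise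
`F y + k ‖y - (z + s v)‖² - σ s` over `y` in the ball and, as an independent variable, over
`s ∈ [0, h]`. For large `k` the minimiser has `y` inside the ball and `s < h`. Minimality in `y`
produces the subgradient `p = -2k (y - (z + s v))`, and minimality in `s`, tested by increasing `s`,
gives `⟨p, v⟩ ≥ σ > M`. -/
theorem le_add_mul_of_inner_subdiff_le {F : X → EReal} (hF : LowerSemicontinuous F)
    (hbot : ∀ y, F y ≠ ⊥) {z v : X} {a M ρ h : ℝ} (ha : F z = a)
    (hM : ∀ y ∈ Metric.closedBall z ρ, ∀ p ∈ subdiff F y, inner ℝ p v ≤ M)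
    (hh : 0 < h) (hρ : h * ‖v‖ < ρ) :
    F (z + h • v) ≤ ((a + M * h : ℝ) : EReal) := by
  by_contra! hcon
  obtain ⟨r, hr1, hr2⟩ := EReal.lt_iff_exists_real_btwn.1 hcon
  have hr1 : a + M * h < r := by exact_mod_cast hr1
  obtain ⟨σ, hσ⟩ : ∃ σ, σ * h = r - a := ⟨(r - a) / h, by field_simp⟩
  have hσM : M < σ := by
    by_contra! hle
    nlinarith
  have hρ0 : 0 < ρ := lt_of_le_of_lt (by positivity) hρ
  obtain ⟨d, hd, hdF, hdρ⟩ : ∃ d > 0, (∀ y, ‖y - (z + h • v)‖ < d → (r : EReal) < F y) ∧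
      d + h * ‖v‖ < ρ := by
    obtain ⟨d, hd, hdF⟩ := Metric.eventually_nhds_iff.1 (hF (z + h • v) r hr2)
    refine ⟨min d ((ρ - h * ‖v‖) / 2), lt_min hd (by linarith), fun y hy => hdF ?_, ?_⟩
    · rw [dist_eq_norm]; exact hy.trans_le (min_le_left _ _)
    · linarith [min_le_right d ((ρ - h * ‖v‖) / 2)]
  obtain ⟨m, hm⟩ : ∃ m : ℝ, ∀ y ∈ Metric.closedBall z ρ, (m : EReal) ≤ F y := by
    obtain ⟨y₀, -, hy₀⟩ := (hF.lowerSemicontinuousOn _).exists_isMinOn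
      (Metric.nonempty_closedBall.2 hρ0.le) (isCompact_closedBall z ρ)
    have hle : F y₀ ≤ a := ha ▸ hy₀ (Metric.mem_closedBall_self hρ0.le)
    have htop : F y₀ ≠ ⊤ := ne_top_of_le_ne_top (EReal.coe_ne_top a) hle
    exact ⟨(F y₀).toReal, fun y hy => (EReal.coe_toReal htop (hbot y₀)).symm ▸ hy₀ hy⟩
  -- With this `k`, a point whose penalised value is at most `F z` lies within `d` of the segment.
  obtain ⟨k, hk0, hk⟩ : ∃ k : ℝ, 0 < k ∧ a - m + |σ| * h < k * d ^ 2 := by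
    refine ⟨(|a - m + |σ| * h| + 1) / d ^ 2, by positivity, ?_⟩
    rw [div_mul_cancel₀ _ (by positivity)]
    linarith [le_abs_self (a - m + |σ| * h)]
  set Φ : X × ℝ → EReal := fun q =>
    F q.1 + ((k * ‖q.1 - (z + q.2 • v)‖ ^ 2 - σ * q.2 : ℝ) : EReal) with hΦ
  have hΦlsc : LowerSemicontinuous Φ := by
    refine (hF.comp continuous_fst).add' (Continuous.lowerSemicontinuous ?_) fun q =>
      EReal.continuousAt_add (Or.inr (EReal.coe_ne_bot _)) (Or.inr (EReal.coe_ne_top _))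
    exact continuous_coe_real_ereal.comp (by fun_prop)
  have hstart : (z, (0 : ℝ)) ∈ Metric.closedBall z ρ ×ˢ Icc 0 h :=
    ⟨Metric.mem_closedBall_self hρ0.le, left_mem_Icc.2 hh.le⟩
  obtain ⟨⟨y, s⟩, ⟨hy, hs⟩, hmin⟩ := (hΦlsc.lowerSemicontinuousOn _).exists_isMinOn
    ⟨_, hstart⟩ ((isCompact_closedBall z ρ).prod isCompact_Icc)
  dsimp only at hy hs
  have hΦa : Φ (y, s) ≤ a := by
    have := isMinOn_iff.1 hmin (z, 0) hstart
    simpa [hΦ, ha] using this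
  obtain ⟨b, hb⟩ : ∃ b : ℝ, F y = b := by
    refine ⟨(F y).toReal, (EReal.coe_toReal (fun htop => ?_) (hbot y)).symm⟩
    simp only [hΦ, htop, EReal.top_add_coe, top_le_iff] at hΦa
    exact EReal.coe_ne_top _ hΦa
  set w := y - (z + s • v) with hw
  have hba : b + (k * ‖w‖ ^ 2 - σ * s) ≤ a := by
    simp only [hΦ, hb, ← hw] at hΦa
    exact_mod_cast hΦa
  have hmb : m ≤ b := by have := hm y hy; rw [hb] at this; exact_mod_cast this
  have hσs : σ * s ≤ |σ| * h :=
    (mul_le_mul_of_nonneg_right (le_abs_self σ) hs.1).trans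
      (mul_le_mul_of_nonneg_left hs.2 (abs_nonneg σ))
  have hwd : ‖w‖ < d := by
    refine lt_of_pow_lt_pow_left₀ 2 hd.le (lt_of_mul_lt_mul_left ?_ hk0.le)
    linarith
  -- At `s = h` the point `y` is `d`-close to `z + h v`, so the penalised value exceeds `r - σ h = F z`.
  have hsh : s < h := by
    refine lt_of_le_of_ne hs.2 fun hsh => ?_
    subst hsh
    have := hdF y hwd
    rw [hb] at this
    have : r < b := by exact_mod_cast this
    nlinarith [sq_nonneg ‖w‖]
  have hyball : y ∈ Metric.ball z ρ := by
    have h1 : y - z = w + s • v := by rw [hw]; abel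
    rw [mem_ball_iff_norm, h1]
    have h2 : s * ‖v‖ ≤ h * ‖v‖ := mul_le_mul_of_nonneg_right hs.2 (norm_nonneg v)
    calc ‖w + s • v‖ ≤ ‖w‖ + ‖s • v‖ := norm_add_le _ _
      _ = ‖w‖ + s * ‖v‖ := by rw [norm_smul, Real.norm_of_nonneg hs.1]
      _ < ρ := by linarith
  have hp : (-(2 * k)) • w ∈ subdiff F y := by
    refine mem_subdiff_of_quadratic_minorant (k := k) hb ?_
    filter_upwards [Metric.isOpen_ball.mem_nhds hyball] with y' hy'
    have h1 := isMinOn_iff.1 hmin (y', s) ⟨Metric.ball_subset_closedBall hy', hs⟩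
    have h2 : ‖y' - (z + s • v)‖ ^ 2 = ‖w‖ ^ 2 + 2 * inner ℝ w (y' - y) + ‖y' - y‖ ^ 2 := by
      rw [← norm_add_sq_real]; congr 2; rw [hw]; abel
    simp only [hΦ, hb, ← hw, h2] at h1
    rw [real_inner_smul_left]
    induction hy' : F y' with
    | bot => exact absurd hy' (hbot y')
    | top => simp
    | coe c =>
      rw [hy'] at h1
      norm_cast at h1 ⊢
      linarith
  have hpM := hM y hy _ hp
  -- A forward step `τ` in `s` costs only the second-order term `k τ² ‖v‖²`; `τ` is chosen so that
  -- `k τ ‖v‖² < σ - M`.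
  rw [real_inner_smul_left] at hpM
  have hK : 0 < k * ‖v‖ ^ 2 + 1 := by positivity
  set τ := min (h - s) ((σ - M) / (k * ‖v‖ ^ 2 + 1)) with hτ
  have hτ0 : 0 < τ := lt_min (by linarith) (div_pos (by linarith) hK)
  have hτ1 : τ ≤ h - s := min_le_left _ _
  have hτ2 : τ * (k * ‖v‖ ^ 2 + 1) ≤ σ - M := (le_div_iff₀ hK).1 (min_le_right _ _)
  have h1 := isMinOn_iff.1 hmin (y, s + τ) ⟨hy, by linarith [hs.1], by linarith⟩
  have h2 : ‖y - (z + (s + τ) • v)‖ ^ 2 =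
      ‖w‖ ^ 2 - 2 * (τ * inner ℝ w v) + τ ^ 2 * ‖v‖ ^ 2 := by
    have : y - (z + (s + τ) • v) = w - τ • v := by rw [hw, add_smul]; abel
    rw [this, norm_sub_sq_real, real_inner_smul_right, norm_smul, mul_pow, Real.norm_eq_abs,
      sq_abs]
  simp only [hΦ, hb, ← hw, h2] at h1
  norm_cast at h1
  have h3 : 0 ≤ τ * (-(2 * k) * inner ℝ w v + k * (τ * ‖v‖ ^ 2) - σ) := by linarith
  have h4 := nonneg_of_mul_nonneg_right h3 hτ0
  linarith

/-- The bound on subgradients must hold for directions near `v`, because the upper contingent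
derivative perturbs the direction as well. -/
theorem upperContingentDeriv_le_of_inner_subdiff_le {F : X → EReal} (hF : LowerSemicontinuous F)
    (hbot : ∀ y, F y ≠ ⊥) {z v : X} {M : ℝ} (hz : F z ≠ ⊤)
    (hM : ∀ᶠ q : X × X in 𝓝 (z, v), ∀ p ∈ subdiff F q.1, inner ℝ p q.2 ≤ M) :
    upperContingentDeriv F z v ≤ M := by
  obtain ⟨a, ha⟩ : ∃ a : ℝ, F z = a := ⟨(F z).toReal, (EReal.coe_toReal hz (hbot z)).symm⟩
  rw [nhds_prod_eq] at hM
  obtain ⟨P, hP, Q, hQ, hPQ⟩ := eventually_prod_iff.1 hM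
  obtain ⟨ρ, hρ, hball⟩ := Metric.nhds_basis_closedBall.eventually_iff.1 hP
  refine limsup_le_of_le (by isBoundedDefault) ?_
  have hle : 𝓝[>] (0 : ℝ) ×ˢ 𝓝 v ≤ 𝓝 (0, v) := by
    rw [nhds_prod_eq]; exact Filter.prod_mono_left _ nhdsWithin_le_nhds
  have hcont : Continuous fun q : ℝ × X => q.1 * ‖q.2‖ := by fun_prop
  filter_upwards [hle (hcont.continuousAt.eventually_lt continuousAt_const
      (by simpa using hρ : (0 : ℝ) * ‖v‖ < ρ)), tendsto_snd.eventually hQ,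
    tendsto_fst.eventually self_mem_nhdsWithin] with q h1 h2 h3
  rw [ha, EReal.sub_div_le_coe_iff h3]
  exact le_add_mul_of_inner_subdiff_le hF hbot ha
    (fun y hy => hPQ (hball hy) h2) h3 h1

end Subgradients

/-! ### The extension by `+∞` and the Hamiltonian -/

section TonelliSetting

variable {n : ℕ}

theorem extendTop_of_nonneg (W : ℝ≥0 × Space n → EReal) {z : SpaceTime n} (hz : 0 ≤ z.fst) :
    extendTop W z = W (z.fst.toNNReal, z.snd) := by
  rw [extendTop, dif_pos hz, Real.toNNReal_of_nonneg hz]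
  rfl

theorem extendTop_of_neg (W : ℝ≥0 × Space n → EReal) {z : SpaceTime n} (hz : z.fst < 0) :
    extendTop W z = ⊤ := by
  rw [extendTop, dif_neg (not_le.2 hz)]

theorem lowerSemicontinuous_extendTop {W : ℝ≥0 × Space n → EReal} (hW : LowerSemicontinuous W) :
    LowerSemicontinuous (extendTop W) := by
  have hfst : Continuous fun z : SpaceTime n => z.fst := by fun_prop
  have hcont : Continuous fun z : SpaceTime n => (z.fst.toNNReal, z.snd) := by fun_prop
  intro z c hc
  rcases le_or_gt 0 z.fst with hz | hz
  · rw [extendTop_of_nonneg W hz] at hc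
    filter_upwards [hW.comp hcont z c hc] with y hy
    rcases le_or_gt 0 y.fst with hy0 | hy0
    · rwa [extendTop_of_nonneg W hy0]
    · exact (extendTop_of_neg W hy0).symm ▸ hy.trans_le le_top
  · filter_upwards [hfst.continuousAt.eventually_lt continuousAt_const hz] with y hy
    rwa [extendTop_of_neg W hy, ← extendTop_of_neg W hz]

theorem extendTop_stPoint (W : ℝ≥0 × Space n → EReal) (t : ℝ≥0) (x : Space n) :
    extendTop W (stPoint t x) = W (t, x) := by
  rw [extendTop_of_nonneg W (z := stPoint t x) t.2]
  simp [stPoint]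

theorem extendTop_ne_bot {W : ℝ≥0 × Space n → EReal} (hW : ∀ z, W z ≠ ⊥) (z : SpaceTime n) :
    extendTop W z ≠ ⊥ := by
  unfold extendTop
  split_ifs
  · exact hW _
  · simp

theorem add_hamiltonian_le_zero_iff {L : Space n → Space n → ℝ} {x p : Space n} {s : ℝ} :
    (s : EReal) + hamiltonian L x p ≤ 0 ↔ ∀ u, s + inner ℝ p u ≤ L x u := by
  rw [add_comm, ← EReal.le_sub_iff_add_le (by simp) (by simp), hamiltonian, iSup_le_iff]
  refine forall_congr' fun u => ?_
  rw [zero_sub, ← EReal.coe_neg, EReal.coe_le_coe_iff]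
  constructor <;> intro h <;> linarith

theorem inner_stPoint (s r : ℝ) (p v : Space n) :
    inner ℝ (stPoint s p) (stPoint r v) = s * r + inner ℝ p v := by
  simp [stPoint, WithLp.prod_inner_apply, mul_comm]

/-! ### Contingent inequalities and the Hamilton-Jacobi inequality -/

theorem mem_effDom_of_mem_subdiff {W : ℝ≥0 × Space n → EReal} {t : ℝ≥0} {x : Space n}
    {p : SpaceTime n} (hp : p ∈ subdiff (extendTop W) (stPoint t x)) : (t, x) ∈ effDom W := by
  have := hp.1
  rwa [effDom, mem_ofPred_eq, extendTop_stPoint] at this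

theorem add_hamiltonian_le_zero_of_lowerContingentDeriv_le {L : Space n → Space n → ℝ}
    {W : ℝ≥0 × Space n → EReal} (hbot : ∀ z, W z ≠ ⊥) {t : ℝ≥0} {x px : Space n} {pt : ℝ}
    (hp : stPoint pt px ∈ subdiff (extendTop W) (stPoint t x))
    (h : ∀ u, lowerContingentDeriv (extendTop W) (stPoint t x) (stPoint 1 (-u)) ≤ L x u) :
    (pt : EReal) + hamiltonian L x (-px) ≤ 0 := by
  refine add_hamiltonian_le_zero_iff.2 fun u => ?_
  have h1 := (inner_le_lowerContingentDeriv (extendTop_ne_bot hbot _) hp _).trans (h u)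
  rw [EReal.coe_le_coe_iff, inner_stPoint] at h1
  simpa using h1

/-- Only the Hamilton-Jacobi inequality at times near `t` is needed, which is what makes the
restriction to positive times harmless. -/
theorem upperContingentDeriv_le_of_add_hamiltonian_le_zero {L : Space n → Space n → ℝ}
    (hL : Continuous fun z : Space n × Space n => L z.1 z.2)
    {W : ℝ≥0 × Space n → EReal} (hbot : ∀ z, W z ≠ ⊥) (hW : LowerSemicontinuous W)
    {t : ℝ≥0} {x : Space n} (htx : (t, x) ∈ effDom W)
    (h : ∀ᶠ s : ℝ≥0 in 𝓝 t, ∀ y pt px, stPoint pt px ∈ subdiff (extendTop W) (stPoint s y) →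
      (pt : EReal) + hamiltonian L y (-px) ≤ 0) (u : Space n) :
    upperContingentDeriv (extendTop W) (stPoint t x) (stPoint 1 (-u)) ≤ L x u := by
  refine EReal.le_of_forall_lt_iff_le.1 fun M hM => ?_
  have hM : L x u < M := by exact_mod_cast hM
  refine upperContingentDeriv_le_of_inner_subdiff_le (lowerSemicontinuous_extendTop hW)
    (extendTop_ne_bot hbot) (by rwa [extendTop_stPoint]) ?_
  have hfst : Continuous fun q : SpaceTime n × SpaceTime n => q.1.fst.toNNReal := by fun_prop
  have hsnd : Continuous fun q : SpaceTime n × SpaceTime n => q.2.fst := by fun_prop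
  have hLc : ContinuousAt (fun q : SpaceTime n × SpaceTime n =>
      q.2.fst * L q.1.snd (-(q.2.fst⁻¹ • q.2.snd))) (stPoint t x, stPoint 1 (-u)) := by
    refine hsnd.continuousAt.mul (hL.continuousAt.comp (ContinuousAt.prodMk (by fun_prop) ?_))
    exact ((hsnd.continuousAt.inv₀ one_ne_zero).smul (by fun_prop)).neg
  filter_upwards [hLc.eventually_lt continuousAt_const (by simpa [stPoint] using hM),
    (by simpa [stPoint] using hfst.tendsto (stPoint t x, stPoint 1 (-u)) :
      Tendsto _ _ (𝓝 t)).eventually h,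
    hsnd.continuousAt.eventually (lt_mem_nhds (zero_lt_one : (0 : ℝ) < 1))]
    with ⟨z, v⟩ h1 h2 h3 p hp
  have hz : 0 ≤ z.fst := by
    by_contra! hneg
    exact hp.1 (extendTop_of_neg W hneg)
  -- The Fenchel inequality at the velocity `-v_x / v_t`, for which `(1, v_x / v_t)` is parallel to `v`.
  have h4 := h2 z.snd p.fst p.snd (by rwa [Real.coe_toNNReal _ hz])
  have h5 := add_hamiltonian_le_zero_iff.1 h4 (-(v.fst⁻¹ • v.snd))
  simp only at h1 h3
  rw [inner_neg_neg, real_inner_smul_right] at h5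
  have h6 : inner ℝ p v = p.fst * v.fst + inner ℝ p.snd v.snd := inner_stPoint _ _ _ _
  have h7 := mul_le_mul_of_nonneg_left h5 h3.le
  rw [mul_add, mul_inv_cancel_left₀ h3.ne'] at h7
  linarith

end TonelliSetting

theorem proposition4p3 (n : ℕ) (L : Space n → Space n → ℝ)
    (hLnonneg : ∀ x u, 0 ≤ L x u)
    (hLcont : Continuous (fun z : Space n × Space n => L z.1 z.2))
    (hLconv : ∀ x, ConvexOn ℝ Set.univ (L x))
    (hLcoer : TonelliCoercive L)
    (W : ℝ≥0 × Space n → EReal)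
    (hWbot : ∀ z, W z ≠ ⊥)
    (hWlsc : LowerSemicontinuous W) :
    List.TFAE [
      ∀ (t : ℝ≥0) (x : Space n), (t, x) ∈ effDom W → ∀ u : Space n,
        upperContingentDeriv (extendTop W) (stPoint (t : ℝ) x) (stPoint 1 (-u)) ≤
          ((L x u : ℝ) : EReal),
      ∀ (t : ℝ≥0) (x : Space n), (t, x) ∈ effDom W → ∀ u : Space n,
        lowerContingentDeriv (extendTop W) (stPoint (t : ℝ) x) (stPoint 1 (-u)) ≤
          ((L x u : ℝ) : EReal),
      ∀ (t : ℝ≥0) (x : Space n) (pt : ℝ) (px : Space n),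
        stPoint pt px ∈ subdiff (extendTop W) (stPoint (t : ℝ) x) →
          (pt : EReal) + hamiltonian L x (-px) ≤ 0] ∧
    List.TFAE [
      ∀ (t : ℝ≥0) (x : Space n), 0 < t → (t, x) ∈ effDom W → ∀ u : Space n,
        upperContingentDeriv (extendTop W) (stPoint (t : ℝ) x) (stPoint 1 (-u)) ≤
          ((L x u : ℝ) : EReal),
      ∀ (t : ℝ≥0) (x : Space n), 0 < t → (t, x) ∈ effDom W → ∀ u : Space n,
        lowerContingentDeriv (extendTop W) (stPoint (t : ℝ) x) (stPoint 1 (-u)) ≤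
          ((L x u : ℝ) : EReal),
      ∀ (t : ℝ≥0) (x : Space n), 0 < t → ∀ (pt : ℝ) (px : Space n),
        stPoint pt px ∈ subdiff (extendTop W) (stPoint (t : ℝ) x) →
          (pt : EReal) + hamiltonian L x (-px) ≤ 0] := by
  constructor
  · tfae_have 1 → 2 := fun h t x htx u => (liminf_le_limsup).trans (h t x htx u)
    tfae_have 2 → 3 := fun h t x pt px hp =>
      add_hamiltonian_le_zero_of_lowerContingentDeriv_le hWbot hp
        (h t x (mem_effDom_of_mem_subdiff hp))
    tfae_have 3 → 1 := fun h t x htx u =>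
      upperContingentDeriv_le_of_add_hamiltonian_le_zero hLcont hWbot hWlsc htx
        (Eventually.of_forall h) u
    tfae_finish
  · tfae_have 1 → 2 := fun h t x ht htx u => (liminf_le_limsup).trans (h t x ht htx u)
    tfae_have 2 → 3 := fun h t x ht pt px hp =>
      add_hamiltonian_le_zero_of_lowerContingentDeriv_le hWbot hp
        (h t x ht (mem_effDom_of_mem_subdiff hp))
    tfae_have 3 → 1 := fun h t x ht htx u => by
      refine upperContingentDeriv_le_of_add_hamiltonian_le_zero hLcont hWbot hWlsc htx ?_ u
      filter_upwards [lt_mem_nhds ht] with s hs y using h s y hs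
    tfae_finish
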